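/- Let $X$ be a finite set of cardinality $n$ and let $S:X\times X\to X\times X$, $S(x,y)=(g_x(y),f_y(x))$, be a non-degenerate symmetric set-theoretical solution of the quantum Yang--Baxter equation; that is, all the maps $f_x,g_x:X\to X$ are bijective, $S\circ S=\mathrm{id}_{X\times X}$, and $S^{12}S^{23}S^{12}=S^{23}S^{12}S^{23}$ on $X^3$, where $S^{i\,i+1}$ is $S$ acting on the $i$th and $(i+1)$th components. Let $$M(X,S)=\langle X\mid xy=g_x(y)f_y(x);\ x,y\in X,\ S(x,y)\neq(x,y)\rangle$$ be its structure monoid, and let $\ell(a)$ be the common length of all words on $X$ that represent $a\in M(X,S)$. A Garside element of a monoid is an element that has the same left divisors as right divisors and whose divisors generate the monoid; *the* Garside element is the one that both left divides and right divides every Garside element. Then $M(X,S)$ has a unique such smallest Garside element $\Delta$. Write $\mathrm{Div}(\Delta)$ for its set of divisors, whose members are the simple elements of $M(X,S)$. 1. Every $a\in\mathrm{Div}(\Delta)$ is represented by exactly $\ell(a)!$ words on $X$. 2. For every integer $k\ge 0$, the number of simple elements of length $k$ is $\binom{n}{k}$ (which is $0$ for $k>n$), and so $\mathrm{Div}(\Delta)$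 has cardinality $2^n$. -/

import Mathlib

namespace SetYB

section Garside

variable {M : Type*} [Monoid M]

/-- `f` is a left divisor of `g`: there is `h` with `g = f h`. -/
def IsLeftDivisor (f g : M) : Prop := ∃ h, g = f * h

/-- `f` is a right divisor of `g`: there is `h` with `g = h f`. -/
def IsRightDivisor (f g : M) : Prop := ∃ h, g = h * f

/-- An element is balanced if its left divisors are exactly its right divisors. -/
def IsBalanced (d : M) : Prop := ∀ a : M, IsLeftDivisor a d ↔ IsRightDivisor a d

/-- `Div d`, the set of (left) divisors; it is used for balanced elements `d` only, for which the
left divisors and the right divisors coincide. -/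
def divisors (d : M) : Set M := {a | IsLeftDivisor a d}

/-- A Garside element: a balanced element whose divisors generate the monoid. -/
def IsGarsideElement (d : M) : Prop :=
  IsBalanced d ∧ Submonoid.closure (divisors d) = ⊤

/-- `d` is *the* Garside element: it is a Garside element, and it is the smallest one, both for
left divisibility and for right divisibility. -/
def IsTheGarsideElement (d : M) : Prop :=
  IsGarsideElement d ∧ ∀ e : M, IsGarsideElement e → IsLeftDivisor d e ∧ IsRightDivisor d e

end Garside

variable {X : Type*}

/-- The map `g_x`, where `S (x, y) = (g_x y, f_y x)`. -/
def g (S : X × X → X × X) (x : X) : X → X := fun y => (S (x, y)).1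

/-- The map `f_y`, where `S (x, y) = (g_x y, f_y x)`. -/
def f (S : X × X → X × X) (y : X) : X → X := fun x => (S (x, y)).2

/-- `S` acting on the first two components of `X³`. -/
def S12 (S : X × X → X × X) : X × X × X → X × X × X :=
  fun p => ((S (p.1, p.2.1)).1, (S (p.1, p.2.1)).2, p.2.2)

/-- `S` acting on the last two components of `X³`. -/
def S23 (S : X × X → X × X) : X × X × X → X × X × X :=
  fun p => (p.1, S p.2)

/-- All the maps `f_x` and `g_x` are bijections. -/
def IsNondegenerate (S : X × X → X × X) : Prop :=
  ∀ x, Function.Bijective (f S x) ∧ Function.Bijective (g S x)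

/-- `S² = id` and `S¹² S²³ S¹² = S²³ S¹² S²³`. -/
def IsSymmetric (S : X × X → X × X) : Prop :=
  S ∘ S = id ∧ S12 S ∘ S23 S ∘ S12 S = S23 S ∘ S12 S ∘ S23 S

/-- The defining relations `x y = g_x(y) f_y(x)`, for all `x, y` such that `S (x, y) ≠ (x, y)`. -/
def rels (S : X × X → X × X) (u v : FreeMonoid X) : Prop :=
  ∃ x y : X, S (x, y) ≠ (x, y) ∧
    u = FreeMonoid.of x * FreeMonoid.of y ∧
    v = FreeMonoid.of (g S x y) * FreeMonoid.of (f S y x)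

/-- The structure monoid `M(X, S)`. -/
abbrev StructureMonoid (S : X × X → X × X) : Type _ := PresentedMonoid (rels S)

/-- The words on `X` that represent the element `a` of `M(X, S)`. -/
def wordReps (S : X × X → X × X) (a : StructureMonoid S) : Set (FreeMonoid X) :=
  {w | PresentedMonoid.mk (rels S) w = a}

/-- The additive length on `M(X, S)` for which every generator has length one, as a morphism. -/
def lengthHom (S : X × X → X × X) : StructureMonoid S →* Multiplicative ℕ :=
  PresentedMonoid.lift (fun _ : X => Multiplicative.ofAdd 1) (by
    rintro u v ⟨x, y, -, rfl, rfl⟩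
    simp)

/-- The length `ℓ(a)` of an element of `M(X, S)`. -/
def length (S : X × X → X × X) (a : StructureMonoid S) : ℕ :=
  Multiplicative.toAdd (lengthHom S a)

/-- The length of an element is the length of any of its word representatives. -/
theorem length_eq_of_mem_wordReps (S : X × X → X × X) (a : StructureMonoid S)
    (w : FreeMonoid X) (hw : w ∈ wordReps S a) : length S a = w.length := by
  obtain rfl : PresentedMonoid.mk (rels S) w = a := hw
  induction w using FreeMonoid.inductionOn' with
  | one => simp [length]
  | of_mul x w ih =>
    have h1 : lengthHom S (PresentedMonoid.mk (rels S) (FreeMonoid.of x)) =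
        Multiplicative.ofAdd 1 := rfl
    simp only [length, map_mul, toAdd_mul, FreeMonoid.length_mul, FreeMonoid.length_of] at ih ⊢
    rw [ih, h1, toAdd_ofAdd]

end SetYB

/-!
Let `x` act on multisets over `X` by the affine map `m ↦ {x} + g_x m`. Involutivity and the braid
relation make this an action of the structure monoid; the image `π a` of `0` under `a` is a cocycle,
`π (a b) = π a + a • π b`. The map `π` is bijective, and it turns left divisibility into inclusion
of multisets and length into cardinality. A generating set contains every `x`, so the cocycle of a
Garside element contains all of `X`, and `Δ` is the element with `π Δ = X`: its divisors are the
elements whose cocycle is multiplicity-free, that is, a subset of `X`. Recording in order the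
letters that a word contributes to the cocycle is a bijection of words, so such an element `a` has
as many words as `π a` has orderings.
-/

namespace SetYB

open PresentedMonoid (of mk)

section Monoid

variable {M : Type*} [Monoid M]

theorem mem_of_irreducible_of_closure_eq_top [Subsingleton Mˣ] {A : Set M}
    (hA : Submonoid.closure A = ⊤) {p : M} (hp : Irreducible p) : p ∈ A := by
  have hpA : p ∈ Submonoid.closure A := hA ▸ Submonoid.mem_top p
  induction hpA using Submonoid.closure_induction with
  | mem p hmem => exact hmem
  | one => exact absurd hp not_irreducible_one
  | mul p q _ _ ihp ihq =>
    rcases hp.eq_one_or_eq_one with rfl | rfl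
    · rw [one_mul] at hp ⊢
      exact ihq hp
    · rw [mul_one] at hp ⊢
      exact ihp hp

/-- If `d = a * c a`, then `c` is an injective self-map of the finite set of left divisors. -/
theorem isBalanced_of_finite_divisors [IsRightCancelMul M] {d : M} (hfin : (divisors d).Finite)
    (hright : ∀ a, IsRightDivisor a d → IsLeftDivisor a d) : IsBalanced d := by
  choose! c hc using fun a (ha : a ∈ divisors d) => ha
  have hmaps : Set.MapsTo c (divisors d) (divisors d) := fun a ha => hright _ ⟨a, hc a ha⟩
  have hinj : Set.InjOn c (divisors d) := by
    intro a ha b hb hab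
    refine mul_right_cancel (b := c a) ?_
    rw [← hc a ha, hab, ← hc b hb]
  have hsurj := ((hfin.injOn_iff_bijOn_of_mapsTo hmaps).1 hinj).surjOn
  refine fun a => ⟨fun ha => ?_, hright a⟩
  obtain ⟨b, hb, rfl⟩ := hsurj ha
  exact ⟨b, hc b hb⟩

end Monoid

theorem encard_setOf_coe_eq_of_nodup {α : Type*} {m : Multiset α} (hm : m.Nodup) :
    {l : List α | (l : Multiset α) = m}.encard = (m.card.factorial : ℕ∞) := by
  classical
  induction m using Quotient.inductionOn with
  | h l₀ =>
    have hset : {l : List α | (l : Multiset α) = l₀} = l₀.permutations.toFinset := by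
      ext l
      simp
    have hl₀ : l₀.permutations.Nodup := List.nodup_permutations l₀ (Multiset.coe_nodup.1 hm)
    rw [Multiset.quot_mk_to_coe, hset, Set.encard_coe_eq_coe_finsetCard,
      List.toFinset_card_of_nodup hl₀, List.length_permutations, Multiset.coe_card]

variable {X : Type*} {S : X × X → X × X}

@[elab_as_elim]
theorem induction_of_mul {p : StructureMonoid S → Prop} (a : StructureMonoid S) (one : p 1)
    (of_mul : ∀ x a, p a → p (of (rels S) x * a)) : p a := by
  induction a using Submonoid.induction_of_closure_eq_top_left
    (PresentedMonoid.closure_range_of (rels S)) with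
  | one => exact one
  | mul_left y hy a ih =>
    obtain ⟨x, rfl⟩ := hy
    exact of_mul x a ih

theorem of_mul_of (x y : X) :
    of (rels S) x * of (rels S) y = of (rels S) (g S x y) * of (rels S) (f S y x) := by
  by_cases h : S (x, y) = (x, y)
  · simp only [g, f, h]
  · exact PresentedMonoid.mk_eq_mk_of_rel ⟨x, y, h, rfl, rfl⟩

section Length

theorem length_of (x : X) : length S (of (rels S) x) = 1 := rfl

theorem length_one : length S 1 = 0 := by
  rw [length, map_one, toAdd_one]

theorem length_mul (a b : StructureMonoid S) : length S (a * b) = length S a + length S b := by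
  rw [length, map_mul, toAdd_mul, ← length, ← length]

theorem length_eq_zero {a : StructureMonoid S} : length S a = 0 ↔ a = 1 := by
  refine ⟨fun h => ?_, fun h => h ▸ length_one⟩
  induction a using induction_of_mul with
  | one => rfl
  | of_mul x a _ =>
    rw [length_mul, length_of] at h
    omega

instance : Subsingleton (StructureMonoid S)ˣ := by
  refine subsingleton_of_forall_eq 1 fun u => Units.ext (length_eq_zero.1 ?_)
  have h : length S u + length S ↑u⁻¹ = 0 := by rw [← length_mul, u.mul_inv, length_one]
  exact (Nat.add_eq_zero_iff.1 h).1

theorem irreducible_of (x : X) : Irreducible (of (rels S) x) := by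
  refine ⟨fun h => ?_, fun a b hab => ?_⟩
  · have hx := length_of (S := S) x
    rw [isUnit_iff_eq_one.1 h, length_one] at hx
    exact zero_ne_one hx
  · have h : length S a + length S b = 1 := by rw [← length_mul, ← hab, length_of]
    rcases Nat.add_eq_one_iff.1 h with ⟨ha, -⟩ | ⟨-, hb⟩
    · exact Or.inl (isUnit_iff_eq_one.2 (length_eq_zero.1 ha))
    · exact Or.inr (isUnit_iff_eq_one.2 (length_eq_zero.1 hb))

theorem isLeftDivisor_antisymm {a b : StructureMonoid S} (hab : IsLeftDivisor a b)
    (hba : IsLeftDivisor b a) : a = b := by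
  obtain ⟨c, rfl⟩ := hab
  obtain ⟨d, hd⟩ := hba
  have h := congrArg (length S) hd
  simp only [length_mul] at h
  obtain rfl : c = 1 := length_eq_zero.1 (by omega)
  exact (mul_one a).symm

end Length

/-- Left non-degeneracy of a solution: all the maps `g_x` are bijections. It makes the
cocycle below a bijection. -/
def IsLeftNondegenerate (S : X × X → X × X) : Prop := ∀ x, Function.Bijective (g S x)

section Cocycle

variable (hn : IsLeftNondegenerate S) (hs : IsSymmetric S)

/-- The map `g_x` as a permutation of `X`. -/
noncomputable def gPerm (x : X) : Equiv.Perm X := Equiv.ofBijective (g S x) (hn x)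

theorem gPerm_apply (x y : X) : gPerm hn x y = g S x y := rfl

include hs in
theorem g_g_f (x y : X) : g S (g S x y) (f S y x) = x :=
  congrArg Prod.fst (congrFun hs.1 (x, y))

include hs in
theorem gPerm_mul_gPerm (x y : X) :
    gPerm hn x * gPerm hn y = gPerm hn (g S x y) * gPerm hn (f S y x) :=
  Equiv.ext fun z => (congrArg Prod.fst (congrFun hs.2 (x, y, z))).symm

/-- The action of the structure monoid on `X` for which a generator `x` acts as `g_x`. -/
noncomputable def permHom : StructureMonoid S →* Equiv.Perm X :=
  PresentedMonoid.lift (gPerm hn) (by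
    rintro u v ⟨x, y, -, rfl, rfl⟩
    simpa only [map_mul, FreeMonoid.lift_eval_of] using gPerm_mul_gPerm hn hs x y)

theorem permHom_of (x : X) : permHom hn hs (of (rels S) x) = gPerm hn x := rfl

/-- The affine map `m ↦ {x} + g_x m` on multisets. -/
noncomputable def affineMap (x : X) : Function.End (Multiset X) :=
  fun m => x ::ₘ m.map (gPerm hn x)

theorem affineMap_mul_affineMap_apply (x y : X) (m : Multiset X) :
    (affineMap hn x * affineMap hn y) m =
      x ::ₘ g S x y ::ₘ m.map (gPerm hn x * gPerm hn y) := by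
  change x ::ₘ (y ::ₘ m.map (gPerm hn y)).map (gPerm hn x) = _
  rw [Multiset.map_cons, Multiset.map_map, gPerm_apply, Equiv.Perm.coe_mul]

include hs in
theorem affineMap_mul_affineMap (x y : X) :
    affineMap hn x * affineMap hn y = affineMap hn (g S x y) * affineMap hn (f S y x) := by
  funext m
  rw [affineMap_mul_affineMap_apply, affineMap_mul_affineMap_apply, g_g_f hs,
    ← gPerm_mul_gPerm hn hs, Multiset.cons_swap]

/-- The affine action of the structure monoid on multisets for which a generator `x` acts as
`m ↦ {x} + g_x m`. -/
noncomputable def affineHom : StructureMonoid S →* Function.End (Multiset X) :=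
  PresentedMonoid.lift (affineMap hn) (by
    rintro u v ⟨x, y, -, rfl, rfl⟩
    simpa only [map_mul, FreeMonoid.lift_eval_of] using affineMap_mul_affineMap hn hs x y)

/-- The cocycle of the structure monoid with values in the free commutative monoid on `X`: the
translation part of the affine action. -/
noncomputable def cocycle (a : StructureMonoid S) : Multiset X := affineHom hn hs a 0

theorem affineHom_of_mul_apply (x : X) (a : StructureMonoid S) (m : Multiset X) :
    affineHom hn hs (of (rels S) x * a) m = x ::ₘ (affineHom hn hs a m).map (gPerm hn x) := by
  rw [map_mul]
  rfl

theorem cocycle_one : cocycle hn hs 1 = 0 := by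
  rw [cocycle, map_one, Function.End.one_def, id]

theorem cocycle_of_mul (x : X) (a : StructureMonoid S) :
    cocycle hn hs (of (rels S) x * a) = x ::ₘ (cocycle hn hs a).map (gPerm hn x) :=
  affineHom_of_mul_apply hn hs x a 0

theorem cocycle_of (x : X) : cocycle hn hs (of (rels S) x) = {x} := rfl

theorem cocycle_mul (a b : StructureMonoid S) :
    cocycle hn hs (a * b) = cocycle hn hs a + (cocycle hn hs b).map (permHom hn hs a) := by
  induction a using induction_of_mul with
  | one => simp [cocycle_one]
  | of_mul x a ih =>
    rw [mul_assoc, cocycle_of_mul, cocycle_of_mul, ih, map_mul, permHom_of, Multiset.map_add,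
      Multiset.map_map, Multiset.cons_add, Equiv.Perm.coe_mul]

theorem card_cocycle (a : StructureMonoid S) : (cocycle hn hs a).card = length S a := by
  induction a using induction_of_mul with
  | one => rw [cocycle_one, Multiset.card_zero, length_one]
  | of_mul x a ih =>
    rw [cocycle_of_mul, Multiset.card_cons, Multiset.card_map, ih, length_mul, length_of, add_comm]

theorem isLeftDivisor_of_of_mem_cocycle {x : X} {a : StructureMonoid S}
    (hx : x ∈ cocycle hn hs a) : IsLeftDivisor (of (rels S) x) a := by
  induction a using induction_of_mul generalizing x with
  | one => simp [cocycle_one] at hx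
  | of_mul y a ih =>
    rw [cocycle_of_mul, Multiset.mem_cons, Multiset.mem_map] at hx
    obtain rfl | ⟨z, hz, rfl⟩ := hx
    · exact ⟨a, rfl⟩
    · obtain ⟨b, rfl⟩ := ih hz
      refine ⟨of (rels S) (f S z y) * b, ?_⟩
      rw [gPerm_apply, ← mul_assoc, ← mul_assoc, of_mul_of]

theorem cocycle_injective : Function.Injective (cocycle hn hs) := by
  intro a b hab
  induction a using induction_of_mul generalizing b with
  | one =>
    refine (length_eq_zero.1 ?_).symm
    rw [← card_cocycle hn hs, ← hab, cocycle_one, Multiset.card_zero]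
  | of_mul x a ih =>
    have hx : x ∈ cocycle hn hs b := by
      rw [← hab, cocycle_of_mul]
      exact Multiset.mem_cons_self x _
    obtain ⟨c, rfl⟩ := isLeftDivisor_of_of_mem_cocycle hn hs hx
    rw [cocycle_of_mul, cocycle_of_mul, Multiset.cons_inj_right] at hab
    rw [ih (Multiset.map_injective (gPerm hn x).injective hab)]

/-- The letters that a word contributes to the cocycle, in the order of the word: `x₁`,
`g_{x₁} x₂`, `g_{x₁} g_{x₂} x₃` and so on. -/
noncomputable def cocycleList : List X → List X
  | [] => []
  | x :: w => x :: (cocycleList w).map (gPerm hn x)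

theorem cocycleList_injective : Function.Injective (cocycleList hn) := by
  intro w w' h
  induction w generalizing w' with
  | nil => cases w' with
    | nil => rfl
    | cons y w' => simp [cocycleList] at h
  | cons x w ih => cases w' with
    | nil => simp [cocycleList] at h
    | cons y w' =>
      simp only [cocycleList, List.cons.injEq] at h
      obtain ⟨rfl, h⟩ := h
      rw [ih (List.map_injective_iff.2 (gPerm hn x).injective h)]

theorem exists_cocycleList_eq_map (l : List X) (σ : Equiv.Perm X) :
    ∃ w, cocycleList hn w = l.map σ := by
  induction l generalizing σ with
  | nil => exact ⟨[], rfl⟩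
  | cons x l ih =>
    obtain ⟨w, hw⟩ := ih ((gPerm hn (σ x))⁻¹ * σ)
    exact ⟨σ x :: w, by simp [cocycleList, hw]⟩

theorem cocycleList_bijective : Function.Bijective (cocycleList hn) :=
  ⟨cocycleList_injective hn, fun l => by simpa using exists_cocycleList_eq_map hn l 1⟩

theorem cocycle_mk_ofList (w : List X) :
    cocycle hn hs (mk (rels S) (FreeMonoid.ofList w)) = cocycleList hn w := by
  induction w with
  | nil => exact cocycle_one hn hs
  | cons x w ih =>
    rw [FreeMonoid.ofList_cons, map_mul, cocycleList, ← Multiset.cons_coe, ← Multiset.map_coe, ← ih]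
    exact cocycle_of_mul hn hs x _

theorem cocycle_surjective : Function.Surjective (cocycle hn hs) := by
  intro m
  induction m using Quotient.inductionOn with
  | h l =>
    obtain ⟨w, rfl⟩ := (cocycleList_bijective hn).surjective l
    exact ⟨_, cocycle_mk_ofList hn hs w⟩

/-- The cocycle as an equivalence. -/
noncomputable def cocycleEquiv : StructureMonoid S ≃ Multiset X :=
  Equiv.ofBijective (cocycle hn hs) ⟨cocycle_injective hn hs, cocycle_surjective hn hs⟩

theorem isLeftDivisor_iff_cocycle_le {a b : StructureMonoid S} :
    IsLeftDivisor a b ↔ cocycle hn hs a ≤ cocycle hn hs b := by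
  constructor
  · rintro ⟨c, rfl⟩
    rw [cocycle_mul]
    exact Multiset.le_add_right _ _
  · intro h
    obtain ⟨m, hm⟩ := Multiset.le_iff_exists_add.1 h
    obtain ⟨c, hc⟩ := cocycle_surjective hn hs (m.map (permHom hn hs a).symm)
    refine ⟨c, cocycle_injective hn hs ?_⟩
    rw [cocycle_mul, hc, hm, Multiset.map_map, Equiv.self_comp_symm, Multiset.map_id]

include hn hs in
theorem isRightCancelMul : IsRightCancelMul (StructureMonoid S) where
  mul_right_cancel c a b h := by
    have hperm : permHom hn hs a = permHom hn hs b := by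
      have := congrArg (permHom hn hs) h
      rwa [map_mul, map_mul, mul_left_inj] at this
    have hcocycle := congrArg (cocycle hn hs) h
    rw [cocycle_mul, cocycle_mul, hperm, add_left_inj] at hcocycle
    exact cocycle_injective hn hs hcocycle

theorem encard_wordReps_of_nodup {a : StructureMonoid S} (ha : (cocycle hn hs a).Nodup) :
    (wordReps S a).encard = ((length S a).factorial : ℕ∞) := by
  have hpre : wordReps S a = FreeMonoid.ofList ''
      (cocycleList hn ⁻¹' {l : List X | (l : Multiset X) = cocycle hn hs a}) := by
    ext w
    rw [Equiv.image_eq_preimage_symm, FreeMonoid.ofList_symm, Set.mem_preimage, Set.mem_preimage,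
      Set.mem_ofPred_eq, ← cocycle_mk_ofList hn hs, FreeMonoid.ofList_toList,
      (cocycle_injective hn hs).eq_iff]
    rfl
  rw [hpre, FreeMonoid.ofList.injective.encard_image,
    Set.encard_preimage_of_bijective (cocycleList_bijective hn),
    encard_setOf_coe_eq_of_nodup ha, card_cocycle]

end Cocycle

section SimpleElements

variable (hn : IsLeftNondegenerate S) (hs : IsSymmetric S)

/-- The element whose cocycle is the finite set `s`, that is, the least element for left
divisibility of which all `x ∈ s` are left divisors. -/
noncomputable def simpleElement (s : Finset X) : StructureMonoid S :=
  (cocycleEquiv hn hs).symm s.val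

theorem cocycle_simpleElement (s : Finset X) : cocycle hn hs (simpleElement hn hs s) = s.val :=
  (cocycleEquiv hn hs).apply_symm_apply s.val

theorem simpleElement_injective : Function.Injective (simpleElement hn hs) :=
  (cocycleEquiv hn hs).symm.injective.comp Finset.val_injective

theorem length_simpleElement (s : Finset X) : length S (simpleElement hn hs s) = s.card := by
  rw [← card_cocycle hn hs, cocycle_simpleElement, Finset.card_val]

theorem divisors_simpleElement (s : Finset X) :
    divisors (simpleElement hn hs s) = simpleElement hn hs '' s.powerset := by
  ext a
  simp only [divisors, Set.mem_ofPred_eq, isLeftDivisor_iff_cocycle_le hn hs,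
    cocycle_simpleElement, Set.mem_image, Finset.mem_coe, Finset.mem_powerset]
  constructor
  · intro h
    refine ⟨⟨cocycle hn hs a, Multiset.nodup_of_le h s.nodup⟩, Finset.val_le_iff.1 h, ?_⟩
    exact cocycle_injective hn hs (cocycle_simpleElement hn hs _)
  · rintro ⟨t, hts, rfl⟩
    rw [cocycle_simpleElement]
    exact Finset.val_le_iff.2 hts

theorem divisors_simpleElement_length_eq (s : Finset X) (k : ℕ) :
    {a | a ∈ divisors (simpleElement hn hs s) ∧ length S a = k} =
      simpleElement hn hs '' s.powersetCard k := by
  ext a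
  simp only [divisors_simpleElement, Set.mem_ofPred_eq, Set.mem_image, Finset.mem_coe,
    Finset.mem_powerset, Finset.mem_powersetCard]
  constructor
  · rintro ⟨⟨t, hts, rfl⟩, hk⟩
    exact ⟨t, ⟨hts, (length_simpleElement hn hs t).symm.trans hk⟩, rfl⟩
  · rintro ⟨t, ⟨hts, hk⟩, rfl⟩
    exact ⟨⟨t, hts, rfl⟩, (length_simpleElement hn hs t).trans hk⟩

theorem encard_divisors_simpleElement (s : Finset X) :
    (divisors (simpleElement hn hs s)).encard = ((2 ^ s.card : ℕ) : ℕ∞) := by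
  rw [divisors_simpleElement, (simpleElement_injective hn hs).encard_image,
    Set.encard_coe_eq_coe_finsetCard, Finset.card_powerset]

theorem encard_divisors_simpleElement_length_eq (s : Finset X) (k : ℕ) :
    {a | a ∈ divisors (simpleElement hn hs s) ∧ length S a = k}.encard =
      (s.card.choose k : ℕ∞) := by
  rw [divisors_simpleElement_length_eq, (simpleElement_injective hn hs).encard_image,
    Set.encard_coe_eq_coe_finsetCard, Finset.card_powersetCard]

theorem encard_wordReps_of_mem_divisors {s : Finset X} {a : StructureMonoid S}
    (ha : a ∈ divisors (simpleElement hn hs s)) :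
    (wordReps S a).encard = ((length S a).factorial : ℕ∞) := by
  rw [divisors_simpleElement] at ha
  obtain ⟨t, -, rfl⟩ := ha
  refine encard_wordReps_of_nodup hn hs ?_
  rw [cocycle_simpleElement]
  exact t.nodup

end SimpleElements

section GarsideElement

variable [Fintype X] (hn : IsLeftNondegenerate S) (hs : IsSymmetric S)

/-- The Garside element `Δ`, the one whose cocycle is all of `X`. -/
noncomputable def garsideElement : StructureMonoid S := simpleElement hn hs Finset.univ

theorem isLeftDivisor_garsideElement_iff {a : StructureMonoid S} :
    IsLeftDivisor a (garsideElement hn hs) ↔ (cocycle hn hs a).Nodup := by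
  rw [isLeftDivisor_iff_cocycle_le hn hs, garsideElement, cocycle_simpleElement]
  refine ⟨fun h => Multiset.nodup_of_le h Finset.univ.nodup, fun h => ?_⟩
  exact (Multiset.le_iff_subset h).2 fun x _ => Finset.mem_univ x

theorem isLeftDivisor_garsideElement_of_isRightDivisor {a : StructureMonoid S}
    (ha : IsRightDivisor a (garsideElement hn hs)) : IsLeftDivisor a (garsideElement hn hs) := by
  obtain ⟨b, hb⟩ := ha
  have hnodup : (cocycle hn hs (b * a)).Nodup := by
    rw [← hb, garsideElement, cocycle_simpleElement]
    exact Finset.univ.nodup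
  rw [cocycle_mul] at hnodup
  rw [isLeftDivisor_garsideElement_iff]
  exact (Multiset.nodup_of_le (Multiset.le_add_left _ _) hnodup).of_map _

theorem isBalanced_garsideElement : IsBalanced (garsideElement hn hs) := by
  have := isRightCancelMul hn hs
  refine isBalanced_of_finite_divisors ?_
    fun _ => isLeftDivisor_garsideElement_of_isRightDivisor hn hs
  rw [garsideElement, divisors_simpleElement]
  exact (Finset.finite_toSet _).image _

theorem isGarsideElement_garsideElement : IsGarsideElement (garsideElement hn hs) := by
  refine ⟨isBalanced_garsideElement hn hs, top_unique ?_⟩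
  rw [← PresentedMonoid.closure_range_of (rels S)]
  refine Submonoid.closure_mono ?_
  rintro _ ⟨x, rfl⟩
  exact (isLeftDivisor_garsideElement_iff hn hs).2 (Multiset.nodup_singleton x)

theorem garsideElement_isLeftDivisor {e : StructureMonoid S}
    (he : Submonoid.closure (divisors e) = ⊤) : IsLeftDivisor (garsideElement hn hs) e := by
  rw [isLeftDivisor_iff_cocycle_le hn hs, garsideElement, cocycle_simpleElement,
    Multiset.le_iff_subset Finset.univ.nodup]
  intro x _
  have hx : IsLeftDivisor (of (rels S) x) e :=
    mem_of_irreducible_of_closure_eq_top he (irreducible_of x)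
  rwa [isLeftDivisor_iff_cocycle_le hn hs, cocycle_of, Multiset.singleton_le] at hx

theorem isTheGarsideElement_garsideElement : IsTheGarsideElement (garsideElement hn hs) := by
  refine ⟨isGarsideElement_garsideElement hn hs, fun e he => ?_⟩
  have hleft := garsideElement_isLeftDivisor hn hs he.2
  exact ⟨hleft, (he.1 _).1 hleft⟩

theorem isTheGarsideElement_iff {d : StructureMonoid S} :
    IsTheGarsideElement d ↔ d = garsideElement hn hs := by
  have hΔ := isTheGarsideElement_garsideElement hn hs
  refine ⟨fun hd => ?_, fun h => h ▸ hΔ⟩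
  exact isLeftDivisor_antisymm (hd.2 _ hΔ.1).1 (hΔ.2 d hd.1).1

end GarsideElement

end SetYB

theorem mainTheorem7 {X : Type*} [Fintype X] (S : X × X → X × X)
    (hnondeg : SetYB.IsNondegenerate S) (hsymm : SetYB.IsSymmetric S) :
    (∃! d : SetYB.StructureMonoid S, SetYB.IsTheGarsideElement d) ∧
    ∀ d : SetYB.StructureMonoid S, SetYB.IsTheGarsideElement d →
      (∀ a ∈ SetYB.divisors d,
        (SetYB.wordReps S a).encard = ((SetYB.length S a).factorial : ℕ∞)) ∧
      (∀ k : ℕ,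
        {a | a ∈ SetYB.divisors d ∧ SetYB.length S a = k}.encard =
          ((Fintype.card X).choose k : ℕ∞)) ∧
      (SetYB.divisors d).encard = ((2 ^ Fintype.card X : ℕ) : ℕ∞) := by
  have hn : SetYB.IsLeftNondegenerate S := fun x => (hnondeg x).2
  simp only [SetYB.isTheGarsideElement_iff hn hsymm, existsUnique_eq, forall_eq, true_and]
  exact ⟨fun _ => SetYB.encard_wordReps_of_mem_divisors hn hsymm,
    SetYB.encard_divisors_simpleElement_length_eq hn hsymm Finset.univ,
    SetYB.encard_divisors_simpleElement hn hsymm Finset.univ⟩
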